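/- Let $a,b\in\mathbb{Q}$, where $b$ is the square of a rational number, and suppose that $f(x)=x^8+ax^4+b$ is irreducible over $\mathbb{Q}$. Write $\mathbb{Q}^2=\{k^2:k\in\mathbb{Q}\}$, let $\sqrt b\ge 0$ be the nonnegative rational square root of $b$, and let $\mathrm{Gal}(f)$ be the Galois group of $f$ over $\mathbb{Q}$, regarded as a permutation group on the eight roots of $f$. Let $8\mathrm{T}j$ be the $j$-th conjugacy class of transitive subgroups of $S_8$ in the numbering of Butler and McKay. The six classes below are represented by the following groups: - $8\mathrm{T}2\cong C_4\times C_2$: $\langle (1\,2\,3\,8)(4\,5\,6\,7),\ (1\,5)(2\,6)(3\,7)(4\,8)\rangle$; - $8\mathrm{T}3\cong C_2^3$: $\langle (1\,8)(2\,3)(4\,5)(6\,7),\ (1\,3)(2\,8)(4\,6)(5\,7),\ (1\,5)(2\,6)(3\,7)(4\,8)\rangle$; - $8\mathrm{T}4\cong D_4$ (order 8): $\langle (1\,2\,3\,8)(4\,5\,6\,7),\ (1\,6)(2\,5)(3\,4)(7\,8)\rangle$; - $8\mathrm{T}9$ (order 16): generated by $8\mathrm{T}3$ as above and $(4\,5)(6\,7)$;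 - $8\mathrm{T}11$ (order 16): $\langle (1\,5)(3\,7),\ (1\,3\,5\,7)(2\,4\,6\,8),\ (1\,4\,5\,8)(2\,3\,6\,7)\rangle$; - $8\mathrm{T}22$ (order 32): generated by $8\mathrm{T}3$ as above, $(2\,3)(4\,5)$ and $(2\,3)(6\,7)$. Then the following algorithm, whose tests are made in the given order and which stops at the first value returned, returns $\mathrm{Gal}(f)$; that is, for a suitable numbering of the roots of $f$, $\mathrm{Gal}(f)$ is the group returned. 1. If $\sqrt b\in\mathbb{Q}^2$, then - (a) if $a+2\sqrt b\in\mathbb{Q}^2$, return 8T3; - (b) else if $a-2\sqrt b\in\mathbb{Q}^2$, return 8T4; - (c) else if $4b-a^2\in\mathbb{Q}^2$, return 8T2; - (d) otherwise, return 8T9. 2. If $\sqrt b\notin\mathbb{Q}^2$, then - (a) if $a+2\sqrt b\in\mathbb{Q}^2$, then - (i) if $2b-a\sqrt b\in\mathbb{Q}^2$, return 8T4; - (ii) else if $-(2b-a\sqrt b)\in\mathbb{Q}^2$, return 8T2; - (iii) otherwise, return 8T9; - (b) else if $a-2\sqrt b\in\mathbb{Q}^2$, then - (i) if $2b+a\sqrt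 b\in\mathbb{Q}^2$, return 8T4; - (ii) else if $-(2b+a\sqrt b)\in\mathbb{Q}^2$, return 8T2; - (iii) otherwise, return 8T9; - (c) else ($a+2\sqrt b\notin\mathbb{Q}^2$ and $a-2\sqrt b\notin\mathbb{Q}^2$) - (i) if $2b-a\sqrt b\in\mathbb{Q}^2$ and $2b+a\sqrt b\in\mathbb{Q}^2$, return 8T4; - (ii) else if $2b-a\sqrt b\in\mathbb{Q}^2$ or $2b+a\sqrt b\in\mathbb{Q}^2$, return 8T9; - (iii) else if at least one of $4b-a^2$, $\sqrt b(a^2-4b)$, $\sqrt b(4b-a^2)$, $-(2b-a\sqrt b)$, $-(2b+a\sqrt b)$ is in $\mathbb{Q}^2$, return 8T11; - (iv) otherwise, return 8T22. -/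

import Mathlib

open Polynomial

/-- The six labels `8Tj` (`j`-th conjugacy class of transitive subgroups of `S₈` in the numbering
of Butler and McKay) that the algorithm can return. -/
inductive OcticLabel
  | T2
  | T3
  | T4
  | T9
  | T11
  | T22

/-- A representative of each of the six conjugacy classes of transitive subgroups of `S₈`, by
generators in cycle notation; the letters `1, …, 8` are written `0, …, 7`.
As abstract groups they are `C₄ × C₂`, `C₂³`, `D₄` (each in its regular representation),
`D₄ × C₂` (order 16), the central product of `C₄` and `D₄` (order 16), and the extraspecial group
`2^{1+4}` of plus type (order 32). -/
def OcticLabel.group : OcticLabel → Subgroup (Equiv.Perm (Fin 8))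
  | .T2 => Subgroup.closure
      {[0, 1, 2, 7].formPerm * [3, 4, 5, 6].formPerm,
       [0, 4].formPerm * [1, 5].formPerm * [2, 6].formPerm * [3, 7].formPerm}
  | .T3 => Subgroup.closure
      {[0, 7].formPerm * [1, 2].formPerm * [3, 4].formPerm * [5, 6].formPerm,
       [0, 2].formPerm * [1, 7].formPerm * [3, 5].formPerm * [4, 6].formPerm,
       [0, 4].formPerm * [1, 5].formPerm * [2, 6].formPerm * [3, 7].formPerm}
  | .T4 => Subgroup.closure
      {[0, 1, 2, 7].formPerm * [3, 4, 5, 6].formPerm,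
       [0, 5].formPerm * [1, 4].formPerm * [2, 3].formPerm * [6, 7].formPerm}
  | .T9 => Subgroup.closure
      {[0, 7].formPerm * [1, 2].formPerm * [3, 4].formPerm * [5, 6].formPerm,
       [0, 2].formPerm * [1, 7].formPerm * [3, 5].formPerm * [4, 6].formPerm,
       [0, 4].formPerm * [1, 5].formPerm * [2, 6].formPerm * [3, 7].formPerm,
       [3, 4].formPerm * [5, 6].formPerm}
  | .T11 => Subgroup.closure
      {[0, 4].formPerm * [2, 6].formPerm,
       [0, 2, 4, 6].formPerm * [1, 3, 5, 7].formPerm,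
       [0, 3, 4, 7].formPerm * [1, 2, 5, 6].formPerm}
  | .T22 => Subgroup.closure
      {[0, 7].formPerm * [1, 2].formPerm * [3, 4].formPerm * [5, 6].formPerm,
       [0, 2].formPerm * [1, 7].formPerm * [3, 5].formPerm * [4, 6].formPerm,
       [0, 4].formPerm * [1, 5].formPerm * [2, 6].formPerm * [3, 7].formPerm,
       [1, 2].formPerm * [3, 4].formPerm,
       [1, 2].formPerm * [5, 6].formPerm}

/-- The Galois group of `f` over `ℚ`, as a permutation group of the roots of `f` in its splitting
field, is `8Tj`: for some numbering of the roots, the group of permutations of the eight letters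
that it induces is the representative of the class `8Tj`.
(Another numbering replaces the induced group by a conjugate in `S₈`.) -/
def HasGaloisLabel (f : ℚ[X]) (t : OcticLabel) : Prop :=
  haveI : Fact (f.map (algebraMap ℚ f.SplittingField)).Splits := ⟨SplittingField.splits f⟩
  ∃ e : f.rootSet f.SplittingField ≃ Fin 8,
    (Gal.galActionHom f f.SplittingField).range.map e.permCongrHom.toMonoidHom = t.group

/-- The decision tree for `x⁸ + a x⁴ + b`, where `b` is a rational square. Here `Rat.sqrt b` is the
nonnegative rational square root of such a `b`, and `IsSquare q` says that `q` is the square of a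
rational number. The tests are made from top to bottom. -/
def deocticAlgorithm (a b : ℚ) : OcticLabel :=
  let s := Rat.sqrt b
  if IsSquare s then
    if IsSquare (a + 2 * s) then .T3
    else if IsSquare (a - 2 * s) then .T4
    else if IsSquare (4 * b - a ^ 2) then .T2
    else .T9
  else if IsSquare (a + 2 * s) then
    if IsSquare (2 * b - a * s) then .T4
    else if IsSquare (-(2 * b - a * s)) then .T2
    else .T9
  else if IsSquare (a - 2 * s) then
    if IsSquare (2 * b + a * s) then .T4
    else if IsSquare (-(2 * b + a * s)) then .T2
    else .T9
  else
    if IsSquare (2 * b - a * s) ∧ IsSquare (2 * b + a * s) then .T4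
    else if IsSquare (2 * b - a * s) ∨ IsSquare (2 * b + a * s) then .T9
    else if IsSquare (4 * b - a ^ 2) ∨ IsSquare (s * (a ^ 2 - 4 * b)) ∨
        IsSquare (s * (4 * b - a ^ 2)) ∨ IsSquare (-(2 * b - a * s)) ∨
        IsSquare (-(2 * b + a * s)) then .T11
    else .T22

/-! Write `b = s²` with `s > 0`, and let `α` be a root of `f`, `c² = s`, `i² = -1`. The roots are
`iᵏα` and `iᵏc/α`, so an automorphism acts on them through the image of `α` and its signs on `i` and
`c`: one of 32 codes. These form a group under composition, and the Galois group yields a transitive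
subgroup `G` of it.

The elements `i`, `c`, `α² ± s/α²` are square roots of `-1`, `s`, `2s - a`, `-2s - a`, and the signs
acquired by them define a homomorphism from codes to `𝔽₂⁴` with kernel generated by `α ↦ -α`.
Transitivity forces this involution into `G` (`AutCode.neg_mem`), so `G` is the full preimage of its
image. By Kummer theory the annihilator of that image consists of the exponent vectors whose
products of radicands are rational squares (`isSquare_prod_radicand_iff`). Thus the square classes
determine `G` (`mem_code_iff`).

Irreducibility and `s > 0` leave ten nonzero vectors that can give squares, exactly those tested by
the algorithm. Two finite checks finish: `exists_mem_table_of_sublist` matches each possible set of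
squares with a table row carrying the algorithm's answer, and `table_represents` verifies that the
row's group is the stated one. -/

/-- Exponent vectors of products of the four quantities `-1`, `s`, `2s - a`, `-2s - a`. -/
abbrev ExpVec := Fin 4 → ZMod 2

/-- Labels of the eight roots of `x⁸ + a x⁴ + s²`: `(k, false)` stands for `iᵏ α` and `(k, true)`
for `iᵏ c / α`, where `c² = s`. -/
abbrev RootLabel := Fin 4 × Bool

/-- Data describing an automorphism: the label of the image of `α`, and whether it
negates `i` and `c`. -/
abbrev AutCode := RootLabel × Bool × Bool

/-! ### The group of 32 codes and its sign homomorphism -/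

namespace AutCode

/-- The permutation of the root labels induced by an automorphism. -/
def act (x : AutCode) (k : RootLabel) : RootLabel :=
  (bif k.2 then (bif x.2.1 then -k.1 else k.1) - x.1.1 + (bif x.2.2 then 2 else 0)
    else (bif x.2.1 then -k.1 else k.1) + x.1.1, xor k.2 x.1.2)

/-- Composition of automorphisms. -/
def comp (x y : AutCode) : AutCode :=
  (x.act y.1, xor x.2.1 y.2.1, xor x.2.2 y.2.2)

/-- The signs by which an automorphism acts on the square roots of `-1`, `s`, `2s - a`,
`-2s - a`. -/
def signs (x : AutCode) : ExpVec :=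
  ![bif x.2.1 then 1 else 0, bif x.2.2 then 1 else 0,
    bif x.1.1 == 1 || x.1.1 == 3 then 1 else 0,
    (bif x.1.1 == 1 || x.1.1 == 3 then 1 else 0) + (bif x.1.2 then 1 else 0)]

theorem signs_comp : ∀ x y : AutCode, (x.comp y).signs = x.signs + y.signs := by
  decide +kernel

theorem signs_comp_self (x : AutCode) : (x.comp x).signs = 0 := by
  rw [signs_comp, ← two_nsmul]
  exact ZModModule.char_nsmul_eq_zero 2 _

/-- The central involution `α ↦ -α`. -/
def neg : AutCode := ((2, false), false, false)

/-- The kernel of the sign homomorphism is `{1, neg}`. -/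
theorem eq_or_eq_neg_comp : ∀ x y : AutCode, x.signs = y.signs → x = y ∨ x = neg.comp y := by
  decide +kernel

/-- If `y` fixes `i` then `y² = neg`; if `t` negates `c` then `t² = neg`. Otherwise either `x` is
already `neg`, or it negates `i` and fails to commute with `y`, or it negates `c` and fails to
commute with `t`. The cubes stand for inverses, since fourth powers are trivial. -/
theorem neg_eq_sq_or_commutator : ∀ x y t : AutCode,
    x.1 = (2, false) → y.1 = (1, false) → t.1 = (0, true) →
    neg = x ∨ neg = y.comp y ∨ neg = t.comp t ∨
    neg = (x.comp y).comp ((y.comp x).comp ((y.comp x).comp (y.comp x))) ∨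
    neg = (x.comp t).comp ((t.comp x).comp ((t.comp x).comp (t.comp x))) := by
  decide +kernel

variable {S : Set AutCode}

theorem neg_mem (hS : ∀ x ∈ S, ∀ y ∈ S, x.comp y ∈ S) (htr : ∀ k, ∃ x ∈ S, x.1 = k) :
    neg ∈ S := by
  obtain ⟨x, hx, hx'⟩ := htr (2, false)
  obtain ⟨y, hy, hy'⟩ := htr (1, false)
  obtain ⟨t, ht, ht'⟩ := htr (0, true)
  have hxy := hS _ hx _ hy
  have hyx := hS _ hy _ hx
  have hxt := hS _ hx _ ht
  have htx := hS _ ht _ hx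
  rcases neg_eq_sq_or_commutator x y t hx' hy' ht' with h | h | h | h | h <;> rw [h]
  exacts [hx, hS _ hy _ hy, hS _ ht _ ht, hS _ hxy _ (hS _ hyx _ (hS _ hyx _ hyx)),
    hS _ hxt _ (hS _ htx _ (hS _ htx _ htx))]

/-- A transitive set of automorphisms closed under composition is cut out by its sign
characters. -/
theorem mem_of_signs (hS : ∀ x ∈ S, ∀ y ∈ S, x.comp y ∈ S) (htr : ∀ k, ∃ x ∈ S, x.1 = k)
    (x : AutCode) (hx : ∀ w : ExpVec, (∀ y ∈ S, w ⬝ᵥ y.signs = 0) → w ⬝ᵥ x.signs = 0) :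
    x ∈ S := by
  let V : AddSubgroup ExpVec :=
    { carrier := signs '' S
      add_mem' := by
        rintro _ _ ⟨y, hy, rfl⟩ ⟨z, hz, rfl⟩
        exact ⟨y.comp z, hS y hy z hz, signs_comp y z⟩
      zero_mem' := by
        obtain ⟨y, hy, -⟩ := htr (0, false)
        exact ⟨y.comp y, hS y hy y hy, signs_comp_self y⟩
      neg_mem' := by
        rintro _ ⟨y, hy, rfl⟩
        exact ⟨y, hy, (ZModModule.neg_eq_self _).symm⟩ }
  -- A vector outside the subspace `V` is detected by a linear functional vanishing on `V`, and
  -- every functional is a dot product.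
  have hxV : x.signs ∈ V := by
    by_contra hxV
    obtain ⟨f, hf, hle⟩ := Submodule.exists_le_ker_of_notMem
      (p := AddSubgroup.toZModSubmodule 2 V) (v := x.signs) hxV
    have hdot : ∀ v, f v = (fun j => f (Pi.single j 1)) ⬝ᵥ v := fun v => by
      rw [LinearMap.pi_apply_eq_sum_univ f v, dotProduct]
      refine Finset.sum_congr rfl fun j _ => ?_
      rw [smul_eq_mul, mul_comm]
      congr 2
      ext l
      simp [Pi.single_apply, eq_comm]
    refine hf ((hdot _).trans (hx _ fun y hy => ?_))
    rw [← hdot]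
    exact hle ⟨y, hy, rfl⟩
  obtain ⟨y, hy, hyx⟩ := hxV
  rcases eq_or_eq_neg_comp x y hyx.symm with rfl | rfl
  exacts [hy, hS _ (neg_mem hS htr) _ hy]

end AutCode

/-! ### Explicit generators and the table of possible groups -/

namespace OcticLabel

/-- Permutations generating the group of an octic label, with repetitions, such that the products
of their sublists exhaust the group. -/
def generators : OcticLabel → List (Equiv.Perm (Fin 8))
  | .T2 => List.replicate 3 ([0, 1, 2, 7].formPerm * [3, 4, 5, 6].formPerm) ++
      [[0, 4].formPerm * [1, 5].formPerm * [2, 6].formPerm * [3, 7].formPerm]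
  | .T3 =>
      [[0, 7].formPerm * [1, 2].formPerm * [3, 4].formPerm * [5, 6].formPerm,
       [0, 2].formPerm * [1, 7].formPerm * [3, 5].formPerm * [4, 6].formPerm,
       [0, 4].formPerm * [1, 5].formPerm * [2, 6].formPerm * [3, 7].formPerm]
  | .T4 => List.replicate 3 ([0, 1, 2, 7].formPerm * [3, 4, 5, 6].formPerm) ++
      [[0, 5].formPerm * [1, 4].formPerm * [2, 3].formPerm * [6, 7].formPerm]
  | .T9 =>
      [[0, 7].formPerm * [1, 2].formPerm * [3, 4].formPerm * [5, 6].formPerm,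
       [0, 2].formPerm * [1, 7].formPerm * [3, 5].formPerm * [4, 6].formPerm,
       [0, 4].formPerm * [1, 5].formPerm * [2, 6].formPerm * [3, 7].formPerm,
       [3, 4].formPerm * [5, 6].formPerm]
  | .T11 => [0, 4].formPerm * [2, 6].formPerm ::
      List.replicate 3 ([0, 2, 4, 6].formPerm * [1, 3, 5, 7].formPerm) ++
      [[0, 3, 4, 7].formPerm * [1, 2, 5, 6].formPerm]
  | .T22 =>
      [[0, 7].formPerm * [1, 2].formPerm * [3, 4].formPerm * [5, 6].formPerm,
       [0, 2].formPerm * [1, 7].formPerm * [3, 5].formPerm * [4, 6].formPerm,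
       [0, 4].formPerm * [1, 5].formPerm * [2, 6].formPerm * [3, 7].formPerm,
       [1, 2].formPerm * [3, 4].formPerm,
       [1, 2].formPerm * [5, 6].formPerm]

theorem group_eq_closure (t : OcticLabel) :
    t.group = Subgroup.closure {g | g ∈ t.generators} := by
  cases t <;> simp only [group, generators] <;> congr 1 <;> ext g <;>
    simp [List.replicate]

/-- The automorphism codes on which the sign characters of the exponent vectors in `W` vanish,
acting on the labels numbered by `π`, induce the representative group of `t`. -/
def Represents (t : OcticLabel) (W : List ExpVec) (π : RootLabel → Fin 8) : Prop :=
  Function.Injective π ∧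
  (∀ g ∈ t.generators, ∃ x : AutCode, (∀ w ∈ W, w ⬝ᵥ x.signs = 0) ∧
    ∀ k, g (π k) = π (x.act k)) ∧
  ∀ x : AutCode, (∀ w ∈ W, w ⬝ᵥ x.signs = 0) →
    ∃ l ∈ t.generators.sublists, ∀ k, l.prod (π k) = π (x.act k)

instance (t : OcticLabel) (W : List ExpVec) (π : RootLabel → Fin 8) :
    Decidable (t.Represents W π) := by
  unfold Represents; exact @instDecidableAnd _ _ _ (@instDecidableAnd _ _ _ _)

/-- The numbering of the root labels `α`, `iα`, …, `c / α`, `ic / α`, … by the values of `v`. -/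
def numbering (v : Fin 8 → Fin 8) (k : RootLabel) : Fin 8 :=
  v (bif k.2 then Fin.natAdd 4 k.1 else Fin.castAdd 4 k.1)

/-- The possible groups of square classes, by generators, with a suitable numbering of the roots
and the resulting group. -/
def table : List (List ExpVec × (Fin 8 → Fin 8) × OcticLabel) :=
 [
  ([], ![0, 1, 7, 2, 4, 6, 3, 5], .T22),
  ([![0, 1, 0, 0]], ![0, 3, 7, 4, 1, 5, 2, 6], .T9),
  ([![0, 1, 0, 1]], ![0, 1, 4, 5, 2, 3, 6, 7], .T11),
  ([![0, 1, 1, 0]], ![0, 3, 7, 4, 1, 6, 2, 5], .T9),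
  ([![0, 1, 1, 1]], ![0, 1, 4, 5, 2, 7, 6, 3], .T11),
  ([![1, 0, 0, 1]], ![0, 1, 7, 2, 4, 6, 3, 5], .T9),
  ([![1, 0, 1, 0]], ![0, 1, 7, 2, 3, 6, 4, 5], .T9),
  ([![1, 0, 1, 1]], ![0, 2, 4, 6, 1, 7, 5, 3], .T11),
  ([![1, 1, 0, 1]], ![0, 3, 7, 4, 5, 1, 6, 2], .T9),
  ([![1, 1, 1, 0]], ![0, 1, 4, 5, 3, 6, 7, 2], .T11),
  ([![1, 1, 1, 1]], ![0, 1, 4, 5, 3, 2, 7, 6], .T11),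
  ([![0, 1, 0, 0], ![1, 0, 0, 1]], ![0, 1, 7, 2, 4, 6, 3, 5], .T3),
  ([![0, 1, 0, 0], ![1, 0, 1, 0]], ![0, 5, 2, 3, 4, 7, 6, 1], .T4),
  ([![0, 1, 0, 0], ![1, 0, 1, 1]], ![0, 5, 2, 3, 4, 7, 6, 1], .T2),
  ([![0, 1, 0, 1], ![1, 0, 1, 0]], ![0, 4, 2, 6, 7, 3, 1, 5], .T2),
  ([![0, 1, 1, 0], ![1, 0, 0, 1]], ![0, 4, 2, 6, 3, 1, 5, 7], .T4),
  ([![0, 1, 1, 0], ![1, 0, 1, 1]], ![0, 1, 2, 7, 3, 4, 5, 6], .T4),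
  ([![0, 1, 1, 1], ![1, 0, 0, 1]], ![0, 4, 2, 6, 3, 1, 5, 7], .T2),
  ([![0, 1, 1, 1], ![1, 0, 1, 0]], ![0, 4, 2, 6, 7, 3, 1, 5], .T4)]

theorem table_represents : ∀ c ∈ table, c.2.2.Represents c.1 (numbering c.2.1) := by
  decide +kernel

end OcticLabel

/-! ### The decision tree on exponent vectors -/

namespace OcticLabel

/-- The nonzero exponent vectors whose products may be rational squares. -/
def admissible : List ExpVec :=
  [![0, 1, 0, 0], ![1, 0, 0, 1], ![1, 0, 1, 0], ![1, 0, 1, 1], ![0, 1, 1, 0],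
   ![1, 1, 1, 0], ![1, 1, 0, 1], ![0, 1, 0, 1], ![0, 1, 1, 1], ![1, 1, 1, 1]]

/-- The decision tree, in terms of the list of exponent vectors whose products are squares. -/
def ofSquares (T : List ExpVec) : OcticLabel :=
  if ![0, 1, 0, 0] ∈ T then
    if ![1, 0, 0, 1] ∈ T then .T3
    else if ![1, 0, 1, 0] ∈ T then .T4
    else if ![1, 0, 1, 1] ∈ T then .T2
    else .T9
  else if ![1, 0, 0, 1] ∈ T then
    if ![0, 1, 1, 0] ∈ T then .T4
    else if ![1, 1, 1, 0] ∈ T then .T2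
    else .T9
  else if ![1, 0, 1, 0] ∈ T then
    if ![1, 1, 0, 1] ∈ T then .T4
    else if ![0, 1, 0, 1] ∈ T then .T2
    else .T9
  else
    if ![0, 1, 1, 0] ∈ T ∧ ![1, 1, 0, 1] ∈ T then .T4
    else if ![0, 1, 1, 0] ∈ T ∨ ![1, 1, 0, 1] ∈ T then .T9
    else if ![1, 0, 1, 1] ∈ T ∨ ![0, 1, 1, 1] ∈ T ∨ ![1, 1, 1, 1] ∈ T ∨
        ![1, 1, 1, 0] ∈ T ∨ ![0, 1, 0, 1] ∈ T then .T11
    else .T22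

instance : DecidableEq OcticLabel
  | .T2, .T2 | .T3, .T3 | .T4, .T4 | .T9, .T9 | .T11, .T11 | .T22, .T22 => isTrue rfl
  | .T2, .T3 | .T2, .T4 | .T2, .T9 | .T2, .T11 | .T2, .T22
  | .T3, .T2 | .T3, .T4 | .T3, .T9 | .T3, .T11 | .T3, .T22
  | .T4, .T2 | .T4, .T3 | .T4, .T9 | .T4, .T11 | .T4, .T22
  | .T9, .T2 | .T9, .T3 | .T9, .T4 | .T9, .T11 | .T9, .T22
  | .T11, .T2 | .T11, .T3 | .T11, .T4 | .T11, .T9 | .T11, .T22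
  | .T22, .T2 | .T22, .T3 | .T22, .T4 | .T22, .T9 | .T22, .T11 => isFalse nofun

/-- The exponent vectors in `T` are those generated by `W`, up to zero. -/
def Generates (W T : List ExpVec) : Prop :=
  (∀ w ∈ W, w ∈ T) ∧ ∀ w ∈ T, ∃ l ∈ W.sublists, w = l.sum

instance (W T : List ExpVec) : Decidable (Generates W T) :=
  @instDecidableAnd _ _ _ (inferInstanceAs (Decidable (∀ w ∈ T, ∃ l ∈ W.sublists, w = l.sum)))

/-- A list of exponent vectors that is closed under addition, up to zero, and compatible with
`-1` not being a sum of two squares. -/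
def IsClosed (T : List ExpVec) : Prop :=
  (∀ u ∈ T, ∀ v ∈ T, u = v ∨ u + v ∈ T) ∧ ¬ (![1, 1, 1, 0] ∈ T ∧ ![0, 1, 0, 1] ∈ T)

instance (T : List ExpVec) : Decidable (IsClosed T) :=
  @instDecidableAnd _ _ (inferInstanceAs (Decidable (∀ u ∈ T, ∀ v ∈ T, u = v ∨ u + v ∈ T))) _

/-- The second clause of `IsClosed` is essential: the set consisting of `![1, 1, 1, 0]`, `![0, 1, 0,
1]` and their sum is closed under addition and would give a group of order 8, while the tree returns
`T11`, of order 16. -/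
theorem exists_mem_table_of_sublist : ∀ T ∈ admissible.sublists, IsClosed T →
    ∃ c ∈ table, c.2.2 = ofSquares T ∧ Generates c.1 T := by
  decide +kernel

end OcticLabel

/-! ### Roots, and automorphisms described by codes -/

/-- A root `α` of `x⁸ + a x⁴ + s²` in an extension of `ℚ`, with square roots of `-1` and `s`. -/
structure OcticRoot (a s : ℚ) (L : Type*) [Field L] [Algebra ℚ L] where
  α : L
  i : L
  c : L
  α_ne : α ≠ 0
  eq_zero : α ^ 8 + algebraMap ℚ L a * α ^ 4 + algebraMap ℚ L s ^ 2 = 0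
  i_sq : i ^ 2 = -1
  c_sq : c ^ 2 = algebraMap ℚ L s

namespace OcticRoot

variable {a s : ℚ} {L : Type*} [Field L] [Algebra ℚ L] (D : OcticRoot a s L)

/-- The root with a given label. -/
def root (k : RootLabel) : L := D.i ^ k.1.val * bif k.2 then D.c / D.α else D.α

theorem i_pow_four : D.i ^ 4 = 1 := by linear_combination (D.i ^ 2 - 1) * D.i_sq

theorem i_ne : D.i ≠ 0 := fun h => by simpa [h] using D.i_sq

theorem c_ne (hs : s ≠ 0) : D.c ≠ 0 := fun h =>
  hs ((algebraMap ℚ L).injective (by rw [← D.c_sq, h]; simp))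

theorem i_pow_add (k l : Fin 4) : D.i ^ (k + l).val = D.i ^ k.val * D.i ^ l.val := by
  rw [← pow_add, Fin.val_add, ← pow_eq_pow_mod _ D.i_pow_four]

theorem i_pow_neg (k : Fin 4) : D.i ^ (-k).val = (D.i ^ k.val)⁻¹ := by
  refine eq_inv_of_mul_eq_one_left ?_
  rw [← i_pow_add, neg_add_cancel]; simp

theorem i_pow_sub (k l : Fin 4) : D.i ^ (k - l).val = D.i ^ k.val / D.i ^ l.val := by
  rw [sub_eq_add_neg, i_pow_add, i_pow_neg, div_eq_mul_inv]

theorem exists_i_pow_eq {y : L} (hy : y ^ 4 = 1) : ∃ k : Fin 4, y = D.i ^ k.val := by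
  have h : (y - 1) * (y + 1) * ((y - D.i) * (y + D.i)) = 0 := by
    linear_combination hy - (y ^ 2 - 1) * D.i_sq
  rcases mul_eq_zero.1 h with h | h <;> rcases mul_eq_zero.1 h with h | h
  · exact ⟨0, by simpa [sub_eq_zero] using h⟩
  · exact ⟨2, by simpa [D.i_sq] using eq_neg_of_add_eq_zero_left h⟩
  · exact ⟨1, by simpa [sub_eq_zero] using h⟩
  · exact ⟨3, by simpa [pow_succ _ 2, D.i_sq] using eq_neg_of_add_eq_zero_left h⟩

theorem root_eq_zero (k : RootLabel) :
    D.root k ^ 8 + algebraMap ℚ L a * D.root k ^ 4 + algebraMap ℚ L s ^ 2 = 0 := by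
  have h4 : (D.i ^ k.1.val) ^ 4 = 1 := by rw [pow_right_comm, D.i_pow_four, one_pow]
  have h8 : (D.i ^ k.1.val) ^ 8 = 1 := by linear_combination ((D.i ^ k.1.val) ^ 4 + 1) * h4
  rw [root, mul_pow, mul_pow, h4, h8]
  cases k.2
  · simpa using D.eq_zero
  · have hα := D.α_ne
    have hc4 : D.c ^ 4 = algebraMap ℚ L s ^ 2 := by
      linear_combination (D.c ^ 2 + algebraMap ℚ L s) * D.c_sq
    have hc8 : D.c ^ 8 = algebraMap ℚ L s ^ 4 := by
      linear_combination (D.c ^ 4 + algebraMap ℚ L s ^ 2) * hc4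
    simp only [cond_true, div_pow, hc4, hc8]
    field_simp
    linear_combination algebraMap ℚ L s ^ 2 * D.eq_zero

theorem exists_root_eq (hs : s ≠ 0) {y : L}
    (hy : y ^ 8 + algebraMap ℚ L a * y ^ 4 + algebraMap ℚ L s ^ 2 = 0) :
    ∃ k, D.root k = y := by
  have hα := D.α_ne
  have hc := D.c_ne hs
  have hc4 : D.c ^ 4 = algebraMap ℚ L s ^ 2 := by
    linear_combination (D.c ^ 2 + algebraMap ℚ L s) * D.c_sq
  -- As a quadratic in `y⁴`, the polynomial has roots `α⁴` and `s²/α⁴ = (c/α)⁴`.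
  have h : (y ^ 4 - D.α ^ 4) * (D.α ^ 4 * y ^ 4 - D.c ^ 4) = 0 := by
    linear_combination D.α ^ 4 * hy - y ^ 4 * D.eq_zero - (y ^ 4 - D.α ^ 4) * hc4
  rcases mul_eq_zero.1 h with h | h
  · obtain ⟨k, hk⟩ := D.exists_i_pow_eq (y := y / D.α) (by
      rw [div_pow, sub_eq_zero.1 h]; exact div_self (pow_ne_zero _ hα))
    exact ⟨(k, false), by rw [root, ← hk]; simp [hα]⟩
  · obtain ⟨k, hk⟩ := D.exists_i_pow_eq (y := D.α * y / D.c) (by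
      rw [div_pow, mul_pow, sub_eq_zero.1 h]; exact div_self (pow_ne_zero _ hc))
    exact ⟨(k, true), by rw [root, ← hk]; simp only [cond_true]; field_simp⟩

/-- The sign attached to a truth value. -/
def sign (L : Type*) [Field L] (e : Bool) : L := bif e then -1 else 1

/-- The automorphism `σ` is described by the code `x`. -/
def HasCode (σ : L ≃ₐ[ℚ] L) (x : AutCode) : Prop :=
  σ D.α = D.root x.1 ∧ σ D.i = sign L x.2.1 * D.i ∧ σ D.c = sign L x.2.2 * D.c

theorem exists_sign {u : L} (σ : L ≃ₐ[ℚ] L) {q : ℚ} (hu : u ^ 2 = algebraMap ℚ L q) :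
    ∃ e, σ u = sign L e * u := by
  have h : σ u ^ 2 = u ^ 2 := by rw [← map_pow, hu, AlgEquiv.commutes]
  rcases sq_eq_sq_iff_eq_or_eq_neg.1 h with h | h
  exacts [⟨false, by simp [sign, h]⟩, ⟨true, by simp [sign, h]⟩]

theorem exists_hasCode_of_map_eq (σ : L ≃ₐ[ℚ] L) {k : RootLabel} (hk : σ D.α = D.root k) :
    ∃ x, D.HasCode σ x ∧ x.1 = k := by
  obtain ⟨e, he⟩ := exists_sign σ (u := D.i) (q := -1) (by simp [D.i_sq])
  obtain ⟨d, hd⟩ := exists_sign σ D.c_sq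
  exact ⟨(k, e, d), ⟨hk, he, hd⟩, rfl⟩

theorem exists_hasCode (hs : s ≠ 0) (σ : L ≃ₐ[ℚ] L) : ∃ x, D.HasCode σ x := by
  obtain ⟨k, hk⟩ := D.exists_root_eq hs (y := σ D.α) (by
    simpa using congrArg σ D.eq_zero)
  obtain ⟨x, hx, -⟩ := D.exists_hasCode_of_map_eq σ hk.symm
  exact ⟨x, hx⟩

variable {D} {σ τ : L ≃ₐ[ℚ] L} {x y : AutCode}

theorem HasCode.map_i_pow (h : D.HasCode σ x) (k : Fin 4) :
    σ (D.i ^ k.val) = D.i ^ (bif x.2.1 then -k else k).val := by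
  rw [map_pow, h.2.1]
  cases x.2.1
  · simp [sign]
  · rw [cond_true, i_pow_neg, sign, cond_true, neg_one_mul, ← inv_pow]
    congr 1
    exact eq_inv_of_mul_eq_one_left (by linear_combination -D.i_sq)

theorem HasCode.map_c (h : D.HasCode σ x) :
    σ D.c = D.i ^ (bif x.2.2 then 2 else 0 : Fin 4).val * D.c := by
  rw [h.2.2]
  cases x.2.2 <;> simp [sign, D.i_sq]

theorem HasCode.map_root (hs : s ≠ 0) (h : D.HasCode σ x) (k : RootLabel) :
    σ (D.root k) = D.root (x.act k) := by
  have hα := D.α_ne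
  have hi := D.i_ne
  have hc := D.c_ne hs
  obtain ⟨k, n⟩ := k
  obtain ⟨⟨m, p⟩, ε, δ⟩ := x
  rw [root, map_mul, h.map_i_pow]
  cases n
  · simp only [cond_false, h.1, root, AutCode.act, Bool.false_bne, i_pow_add]
    ring
  · simp only [cond_true, map_div₀, h.1, h.map_c, root, AutCode.act, i_pow_add, i_pow_sub]
    cases p <;> simp <;> field_simp

theorem HasCode.mul (hs : s ≠ 0) (hσ : D.HasCode σ x) (hτ : D.HasCode τ y) :
    D.HasCode (σ * τ) (x.comp y) := by
  have hsign : ∀ (ρ : L ≃ₐ[ℚ] L) e, ρ (sign L e) = sign L e := fun ρ e => by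
    cases e <;> simp [sign]
  have hxor : ∀ d e, sign L (xor d e) = sign L e * sign L d := fun d e => by
    cases d <;> cases e <;> simp [sign]
  refine ⟨?_, ?_, ?_⟩
  · rw [AlgEquiv.mul_apply, hτ.1, hσ.map_root hs]; rfl
  · rw [AlgEquiv.mul_apply, hτ.2.1, map_mul, hsign, hσ.2.1, ← mul_assoc, AutCode.comp, hxor]
  · rw [AlgEquiv.mul_apply, hτ.2.2, map_mul, hsign, hσ.2.2, ← mul_assoc, AutCode.comp, hxor]

/-! ### Kummer theory of the radicands -/

/-- The rational numbers generating the largest elementary abelian `2`-subextension. -/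
def radicand (a s : ℚ) : Fin 4 → ℚ := ![-1, s, 2 * s - a, -2 * s - a]

variable (D) in
/-- Square roots of the radicands. -/
def radical : Fin 4 → L :=
  ![D.i, D.c, D.α ^ 2 + algebraMap ℚ L s / D.α ^ 2, D.α ^ 2 - algebraMap ℚ L s / D.α ^ 2]

theorem radical_sq (j : Fin 4) : D.radical j ^ 2 = algebraMap ℚ L (radicand a s j) := by
  have hα := D.α_ne
  have h := D.eq_zero
  fin_cases j
  · simp [radical, radicand, D.i_sq]
  · simp [radical, radicand, D.c_sq]
  · simp only [radical, radicand, map_sub, map_mul, map_ofNat, Fin.reduceFinMk,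
      Matrix.cons_val]
    field_simp
    linear_combination h
  · simp only [radical, radicand, map_sub, map_mul, map_neg, map_ofNat, Fin.reduceFinMk,
      Matrix.cons_val]
    field_simp
    linear_combination h

/-- If `α` goes to `iᵐα` or `iᵐc/α`, then `α²` and `s/α²` are multiplied by `(-1)ᵐ`, and in the
second case also swapped. The swap fixes their sum and negates their difference. -/
theorem HasCode.map_radical (hs : s ≠ 0) (h : D.HasCode σ x) (j : Fin 4) :
    σ (D.radical j) = (-1) ^ (x.signs j).val * D.radical j := by
  have hα := D.α_ne
  have hs' : algebraMap ℚ L s ≠ 0 := by simpa [-eq_ratCast] using hs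
  have h11 : (1 + 1 : ZMod 2) = 0 := rfl
  obtain ⟨⟨m, n⟩, ε, δ⟩ := x
  have h2 : σ (D.α ^ 2) = (-1) ^ m.val * bif n then algebraMap ℚ L s / D.α ^ 2 else D.α ^ 2 := by
    rw [map_pow, h.1, root, mul_pow, ← pow_mul, mul_comm _ 2, pow_mul, D.i_sq]
    cases n <;> simp [div_pow, D.c_sq]
  have h3 : σ (algebraMap ℚ L s / D.α ^ 2) =
      (-1) ^ m.val * bif n then D.α ^ 2 else algebraMap ℚ L s / D.α ^ 2 := by
    have h1 : ((-1 : L) ^ m.val) * (-1) ^ m.val = 1 := by rw [← mul_pow]; simp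
    have h0 : (-1 : L) ^ m.val ≠ 0 := left_ne_zero_of_mul_eq_one h1
    rw [map_div₀, AlgEquiv.commutes, h2, div_eq_iff (mul_ne_zero h0 (by cases n <;> simp [hα, hs,
      -eq_ratCast]))]
    cases n <;> simp only [cond_true, cond_false] <;> field_simp <;> linear_combination -h1
  fin_cases j
  · cases ε <;> simpa [radical, AutCode.signs, sign, ZMod.val_one] using h.2.1
  · cases δ <;> simpa [radical, AutCode.signs, sign, ZMod.val_one] using h.2.2
  · simp only [radical, AutCode.signs, Fin.reduceFinMk, Matrix.cons_val, map_add, h2, h3]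
    fin_cases m <;> cases n <;> simp [ZMod.val_one] <;> ring
  · simp only [radical, AutCode.signs, Fin.reduceFinMk, Matrix.cons_val, map_sub, h2, h3]
    fin_cases m <;> cases n <;> simp [ZMod.val_one, h11] <;> ring

theorem HasCode.map_prod_radical (hs : s ≠ 0) (h : D.HasCode σ x) (w : ExpVec) :
    σ (∏ j, D.radical j ^ (w j).val) =
      (-1) ^ (w ⬝ᵥ x.signs).val * ∏ j, D.radical j ^ (w j).val := by
  have hmod : ∀ n : ℕ, (-1 : L) ^ n = (-1) ^ (n : ZMod 2).val := fun n => by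
    rw [ZMod.val_natCast, ← neg_one_pow_eq_pow_mod_two]
  rw [map_prod]
  simp only [map_pow, h.map_radical hs, mul_pow, Finset.prod_mul_distrib, ← pow_mul,
    Finset.prod_pow_eq_pow_sum]
  rw [hmod (∑ _, _)]
  simp [dotProduct, mul_comm]

/-- A product of radicands is a square exactly when the corresponding sign character vanishes. -/
theorem isSquare_prod_radicand_iff [FiniteDimensional ℚ L] [IsGalois ℚ L] (hs : s ≠ 0)
    (D : OcticRoot a s L) (hne : ∀ j, radicand a s j ≠ 0) (w : ExpVec) :
    IsSquare (∏ j, radicand a s j ^ (w j).val) ↔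
      ∀ σ x, D.HasCode σ x → w ⬝ᵥ x.signs = 0 := by
  have hchar : CharZero L := algebraRat.charZero L
  set u := ∏ j, D.radical j ^ (w j).val with hu
  have hsq : u ^ 2 = algebraMap ℚ L (∏ j, radicand a s j ^ (w j).val) := by
    rw [hu, ← Finset.prod_pow, map_prod]
    refine Finset.prod_congr rfl fun j _ => ?_
    rw [pow_right_comm, radical_sq, map_pow]
  have hu0 : u ≠ 0 := by
    intro h
    rw [h, zero_pow two_ne_zero, eq_comm, map_eq_zero] at hsq
    exact Finset.prod_ne_zero_iff.2 (fun j _ => pow_ne_zero _ (hne j)) hsq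
  constructor
  · rintro ⟨r, hr⟩ σ x hx
    have hur : u ∈ Set.range (algebraMap ℚ L) := by
      rw [hr, map_mul, ← pow_two] at hsq
      rcases sq_eq_sq_iff_eq_or_eq_neg.1 hsq with h | h
      exacts [⟨r, h.symm⟩, ⟨-r, by rw [h, map_neg]⟩]
    obtain ⟨r, hr⟩ := hur
    have h := hx.map_prod_radical hs w
    rw [← hu, ← hr, AlgEquiv.commutes, hr] at h
    by_contra h0
    have h1 : w ⬝ᵥ x.signs = 1 := by
      revert h0; generalize w ⬝ᵥ x.signs = z; revert z; decide
    rw [h1, ZMod.val_one, pow_one, neg_one_mul] at h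
    exact hu0 (self_eq_neg.1 h)
  · intro h
    -- All signs on `u` are trivial, so `u` is Galois-invariant and hence a rational square root of
    -- the product.
    obtain ⟨r, hr⟩ := (IsGalois.mem_range_algebraMap_iff_fixed u).2 fun σ => by
      obtain ⟨x, hx⟩ := D.exists_hasCode hs σ
      rw [hu, hx.map_prod_radical hs w, h σ x hx]
      simp
    refine ⟨r, (algebraMap ℚ L).injective ?_⟩
    rw [← hsq, ← hr, map_mul, pow_two]

end OcticRoot

/-! ### Squares excluded by irreducibility -/

theorem not_irreducible_quartic_mul (p q p' q' : ℚ) :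
    ¬ Irreducible ((X ^ 4 + C p * X ^ 2 + C q) * (X ^ 4 + C p' * X ^ 2 + C q') : ℚ[X]) := by
  have hdeg : ∀ u v : ℚ, (X ^ 4 + C u * X ^ 2 + C v : ℚ[X]).natDegree = 4 := fun u v => by
    compute_degree!
  intro h
  rcases h.isUnit_or_isUnit rfl with h | h
  · simpa [hdeg] using natDegree_eq_zero_of_isUnit h
  · simpa [hdeg] using natDegree_eq_zero_of_isUnit h

section Irreducible

variable {a s : ℚ} (hf : Irreducible (X ^ 8 + C a * X ^ 4 + C (s * s) : ℚ[X]))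
include hf

theorem ne_zero_of_irreducible : s ≠ 0 := by
  rintro rfl
  refine not_irreducible_quartic_mul 0 0 0 a ?_
  convert hf using 1
  simp
  ring

/-- Difference of squares: `f = (x⁴ + s)² - (2s - a)x⁴`. -/
theorem not_isSquare_two_mul_sub : ¬ IsSquare (2 * s - a) := by
  rintro ⟨r, hr⟩
  refine not_irreducible_quartic_mul r s (-r) s ?_
  convert hf using 1
  have h := congrArg (C : ℚ → ℚ[X]) hr
  simp only [map_sub, map_mul, map_ofNat, map_neg] at h ⊢
  linear_combination X ^ 4 * h

/-- Difference of squares: `f = (x⁴ - s)² - (-2s - a)x⁴`. -/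
theorem not_isSquare_neg_two_mul_sub : ¬ IsSquare (-2 * s - a) := by
  rintro ⟨r, hr⟩
  refine not_irreducible_quartic_mul r (-s) (-r) (-s) ?_
  convert hf using 1
  have h := congrArg (C : ℚ → ℚ[X]) hr
  simp only [map_sub, map_mul, map_ofNat, map_neg] at h ⊢
  linear_combination X ^ 4 * h

/-- The product is `a² - 4s²`, the discriminant of `f` as a quadratic in `x⁴`. -/
theorem not_isSquare_mul_radicands : ¬ IsSquare ((2 * s - a) * (-2 * s - a)) := by
  rintro ⟨r, hr⟩
  refine not_irreducible_quartic_mul 0 ((a + r) / 2) 0 ((a - r) / 2) ?_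
  convert hf using 1
  have h : C ((a + r) / 2) * C ((a - r) / 2) = (C (s * s) : ℚ[X]) := by
    rw [← C_mul]; congr 1; linear_combination hr / 4
  have h' : C ((a + r) / 2) + C ((a - r) / 2) = (C a : ℚ[X]) := by
    rw [← C_add]; congr 1; ring
  simp only [map_zero]
  linear_combination h + X ^ 4 * h'

end Irreducible

/-! ### Existence of root data, and agreement with the algorithm -/

namespace OcticRoot

open OcticLabel

variable {a s : ℚ} {L : Type*} [Field L] [Algebra ℚ L]

theorem nonempty_of_splits
    (h : ((X ^ 8 + C a * X ^ 4 + C (s * s) : ℚ[X]).map (algebraMap ℚ L)).Splits)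
    (hs : s ≠ 0) : Nonempty (OcticRoot a s L) := by
  set a' := algebraMap ℚ L a
  set s' := algebraMap ℚ L s with hs'
  have hs0 : s' ≠ 0 := by simpa [hs', -eq_ratCast] using hs
  have hmap : (X ^ 8 + C a * X ^ 4 + C (s * s) : ℚ[X]).map (algebraMap ℚ L) =
      X ^ 8 + C a' * X ^ 4 + C (s' ^ 2) := by
    simp only [Polynomial.map_add, Polynomial.map_mul, Polynomial.map_pow, map_X, map_C, map_mul,
      sq, a', s']
  rw [hmap] at h
  have hdeg : (X ^ 8 + C a' * X ^ 4 + C (s' ^ 2)).natDegree = 8 := by compute_degree!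
  have hne : (X ^ 8 + C a' * X ^ 4 + C (s' ^ 2)) ≠ 0 :=
    ne_zero_of_natDegree_gt (n := 0) (by rw [hdeg]; norm_num)
  obtain ⟨α, hα⟩ := h.exists_eval_eq_zero (degree_ne_of_natDegree_ne (n := 0) (by rw [hdeg]; norm_num))
  simp only [eval_add, eval_mul, eval_pow, eval_X, eval_C] at hα
  have hα0 : α ≠ 0 := by rintro rfl; simp [hs0] at hα
  have hC : C α ^ 8 + C a' * C α ^ 4 + C (s' ^ 2) = 0 := by
    rw [← C_pow, ← C_pow, ← C_mul, ← C_add, ← C_add, hα, C_0]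
  -- Both this and `hβ` use `f = (x⁴ - α⁴)(x⁴ + α⁴ + a)` over `L`; factors of a split polynomial
  -- have roots.
  have hγ : ∃ γ, γ ^ 2 + α ^ 2 = 0 := by
    obtain ⟨γ, hγ⟩ := (h.of_dvd hne (f := X ^ 2 + C (α ^ 2))
      ⟨(X ^ 2 - C (α ^ 2)) * (X ^ 4 + C (α ^ 4 + a')), by
        simp only [C_add, C_pow] at hC ⊢
        linear_combination hC⟩).exists_eval_eq_zero
      (degree_ne_of_natDegree_ne (n := 0) (by
        have : (X ^ 2 + C (α ^ 2)).natDegree = 2 := by compute_degree!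
        rw [this]; norm_num))
    exact ⟨γ, by simpa using hγ⟩
  have hβ : ∃ β, β ^ 4 + (α ^ 4 + a') = 0 := by
    obtain ⟨β, hβ⟩ := (h.of_dvd hne (f := X ^ 4 + C (α ^ 4 + a'))
      ⟨X ^ 4 - C (α ^ 4), by
        simp only [C_add, C_pow] at hC ⊢
        linear_combination hC⟩).exists_eval_eq_zero
      (degree_ne_of_natDegree_ne (n := 0) (by
        have : (X ^ 4 + C (α ^ 4 + a')).natDegree = 4 := by compute_degree!
        rw [this]; norm_num))
    exact ⟨β, by simpa using hβ⟩
  obtain ⟨γ, hγ⟩ := hγ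
  obtain ⟨β, hβ⟩ := hβ
  have hi : (γ / α) ^ 2 = -1 := by
    rw [div_pow, eq_neg_of_add_eq_zero_left hγ, neg_div, div_self (pow_ne_zero 2 hα0)]
  -- `(αβ)² = ±s`; for the minus sign, multiplying `αβ` by `i = γ/α` corrects it.
  have hc : ((α * β) ^ 2) ^ 2 = s' ^ 2 := by linear_combination α ^ 4 * hβ - hα
  rcases sq_eq_sq_iff_eq_or_eq_neg.1 hc with hc | hc
  · exact ⟨⟨α, γ / α, α * β, hα0, hα, hi, hc⟩⟩
  · exact ⟨⟨α, γ / α, γ / α * (α * β), hα0, hα, hi, by rw [mul_pow, hi, hc]; ring⟩⟩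

theorem isSquare_prod_radicand_add [FiniteDimensional ℚ L] [IsGalois ℚ L] (hs : s ≠ 0)
    (D : OcticRoot a s L) (hne : ∀ j, radicand a s j ≠ 0) {u v : ExpVec}
    (hu : IsSquare (∏ j, radicand a s j ^ (u j).val))
    (hv : IsSquare (∏ j, radicand a s j ^ (v j).val)) :
    IsSquare (∏ j, radicand a s j ^ ((u + v) j).val) := by
  rw [D.isSquare_prod_radicand_iff hs hne] at *
  intro σ x hx
  rw [add_dotProduct, hu σ x hx, hv σ x hx, add_zero]

section Irreducible

variable (hf : Irreducible (X ^ 8 + C a * X ^ 4 + C (s * s) : ℚ[X]))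
include hf

theorem radicand_ne_zero (j : Fin 4) : radicand a s j ≠ 0 := by
  fin_cases j
  · simp [radicand]
  · simpa [radicand] using ne_zero_of_irreducible hf
  · intro h
    exact not_isSquare_two_mul_sub hf (h.symm ▸ IsSquare.zero : IsSquare (radicand a s 2))
  · intro h
    exact not_isSquare_neg_two_mul_sub hf (h.symm ▸ IsSquare.zero : IsSquare (radicand a s 3))

theorem eq_zero_or_mem_admissible (hs : 0 < s) {w : ExpVec}
    (hw : IsSquare (∏ j, radicand a s j ^ (w j).val)) : w = 0 ∨ w ∈ admissible := by
  have hcase : ∀ w : ExpVec, (w = 0 ∨ w ∈ admissible) ∨ w = ![1, 0, 0, 0] ∨ w = ![1, 1, 0, 0] ∨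
      w = ![0, 0, 1, 0] ∨ w = ![0, 0, 0, 1] ∨ w = ![0, 0, 1, 1] := by decide +kernel
  rcases hcase w with h | rfl | rfl | rfl | rfl | rfl
  · exact h
  all_goals
    exfalso
    simp [Fin.prod_univ_four, radicand, ZMod.val_one] at hw
  -- The product `-1` was already refuted by `simp`; here it is `-s < 0`.
  · exact absurd hw.nonneg (by linarith)
  · exact not_isSquare_two_mul_sub hf hw
  · exact not_isSquare_neg_two_mul_sub hf (by simpa using hw)
  · exact not_isSquare_mul_radicands hf (by simpa using hw)

open Classical in
/-- Some entry of the table lists generators of the group of exponent vectors whose products are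
squares, and its label is the one returned by the algorithm. -/
theorem exists_mem_table [FiniteDimensional ℚ L] [IsGalois ℚ L] (hs : 0 < s)
    (D : OcticRoot a s L) :
    ∃ c ∈ table, c.2.2 = deocticAlgorithm a (s * s) ∧
      (∀ w ∈ c.1, IsSquare (∏ j, radicand a s j ^ (w j).val)) ∧
      ∀ w, IsSquare (∏ j, radicand a s j ^ (w j).val) → ∃ l ∈ c.1.sublists, w = l.sum := by
  let T := admissible.filter fun w => IsSquare (∏ j, radicand a s j ^ (w j).val)
  have hT : ∀ {w}, w ∈ T ↔ w ∈ admissible ∧ IsSquare (∏ j, radicand a s j ^ (w j).val) := by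
    intro w
    simp only [T, List.mem_filter, decide_eq_true_eq]
  have hT' : ∀ {w}, w ∈ admissible →
      (w ∈ T ↔ IsSquare (∏ j, radicand a s j ^ (w j).val)) := fun h => hT.trans (and_iff_right h)
  have e1 : ![0, 1, 0, 0] ∈ T ↔ IsSquare s := by
    rw [hT' (by decide)]
    simp [Fin.prod_univ_four, radicand, ZMod.val_one]
  have e2 : ![1, 0, 0, 1] ∈ T ↔ IsSquare (a + 2 * s) := by
    rw [hT' (by decide)]
    simp [Fin.prod_univ_four, radicand, ZMod.val_one]
  have e3 : ![1, 0, 1, 0] ∈ T ↔ IsSquare (a - 2 * s) := by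
    rw [hT' (by decide)]
    simp [Fin.prod_univ_four, radicand, ZMod.val_one]
  have e4 : ![1, 0, 1, 1] ∈ T ↔ IsSquare (4 * (s * s) - a ^ 2) := by
    rw [hT' (by decide)]
    refine iff_of_eq (congrArg _ ?_)
    simp [Fin.prod_univ_four, radicand, ZMod.val_one]
    ring
  have e5 : ![0, 1, 1, 0] ∈ T ↔ IsSquare (2 * (s * s) - a * s) := by
    rw [hT' (by decide)]
    refine iff_of_eq (congrArg _ ?_)
    simp [Fin.prod_univ_four, radicand, ZMod.val_one]
    ring
  have e6 : ![1, 1, 1, 0] ∈ T ↔ IsSquare (-(2 * (s * s) - a * s)) := by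
    rw [hT' (by decide)]
    refine iff_of_eq (congrArg _ ?_)
    simp [Fin.prod_univ_four, radicand, ZMod.val_one]
    ring
  have e7 : ![1, 1, 0, 1] ∈ T ↔ IsSquare (2 * (s * s) + a * s) := by
    rw [hT' (by decide)]
    refine iff_of_eq (congrArg _ ?_)
    simp [Fin.prod_univ_four, radicand, ZMod.val_one]
    ring
  have e8 : ![0, 1, 0, 1] ∈ T ↔ IsSquare (-(2 * (s * s) + a * s)) := by
    rw [hT' (by decide)]
    refine iff_of_eq (congrArg _ ?_)
    simp [Fin.prod_univ_four, radicand, ZMod.val_one]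
    ring
  have e9 : ![0, 1, 1, 1] ∈ T ↔ IsSquare (s * (a ^ 2 - 4 * (s * s))) := by
    rw [hT' (by decide)]
    refine iff_of_eq (congrArg _ ?_)
    simp [Fin.prod_univ_four, radicand, ZMod.val_one]
    ring
  have e10 : ![1, 1, 1, 1] ∈ T ↔ IsSquare (s * (4 * (s * s) - a ^ 2)) := by
    rw [hT' (by decide)]
    refine iff_of_eq (congrArg _ ?_)
    simp [Fin.prod_univ_four, radicand, ZMod.val_one]
    ring
  have hclosed : IsClosed T := by
    refine ⟨fun u hu v hv => or_iff_not_imp_left.2 fun huv => ?_, fun ⟨h6, h8⟩ => ?_⟩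
    · have huv' := D.isSquare_prod_radicand_add hs.ne' (radicand_ne_zero hf)
        (hT.1 hu).2 (hT.1 hv).2
      refine hT.2 ⟨(eq_zero_or_mem_admissible hf hs huv').resolve_left fun h => huv ?_, huv'⟩
      rw [eq_neg_of_add_eq_zero_left h]
      exact ZModModule.neg_eq_self v
    -- The two alleged squares add up to `-4s² < 0`.
    · have h6 := (e6.1 h6).nonneg
      have h8 := (e8.1 h8).nonneg
      nlinarith [mul_pos hs hs]
  obtain ⟨c, hc, hlabel, hmem, hgen⟩ :=
    exists_mem_table_of_sublist T (List.mem_sublists.2 List.filter_sublist) hclosed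
  refine ⟨c, hc, ?_, fun w hw => (hT.1 (hmem w hw)).2, fun w hw => ?_⟩
  · rw [hlabel]
    simp only [ofSquares, deocticAlgorithm, Rat.sqrt_eq, abs_of_pos hs, e1, e2, e3, e4, e5, e6, e7,
      e8, e9, e10]
  · rcases eq_zero_or_mem_admissible hf hs hw with rfl | h
    · exact ⟨[], by simp, by simp⟩
    · exact hgen w (hT.2 ⟨h, hw⟩)

end Irreducible

end OcticRoot

/-! ### Identification of the Galois group -/

namespace OcticRoot

open OcticLabel

variable {a s : ℚ} {L : Type*} [Field L] [Algebra ℚ L]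

theorem mem_rootSet_iff {y : L} :
    y ∈ (X ^ 8 + C a * X ^ 4 + C (s * s) : ℚ[X]).rootSet L ↔
      y ^ 8 + algebraMap ℚ L a * y ^ 4 + algebraMap ℚ L s ^ 2 = 0 := by
  have hne : (X ^ 8 + C a * X ^ 4 + C (s * s) : ℚ[X]) ≠ 0 :=
    ne_zero_of_natDegree_gt (n := 0) (by
      have : (X ^ 8 + C a * X ^ 4 + C (s * s) : ℚ[X]).natDegree = 8 := by compute_degree!
      rw [this]; norm_num)
  rw [mem_rootSet_of_ne hne, map_add, map_add, map_mul, map_pow, map_pow, aeval_X, aeval_C,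
    aeval_C, map_mul, ← sq]

variable (hf : Irreducible (X ^ 8 + C a * X ^ 4 + C (s * s) : ℚ[X]))
include hf

theorem root_bijective
    (hsplit : ((X ^ 8 + C a * X ^ 4 + C (s * s) : ℚ[X]).map (algebraMap ℚ L)).Splits)
    (D : OcticRoot a s L) :
    Function.Bijective fun k => (⟨D.root k, mem_rootSet_iff.2 (D.root_eq_zero k)⟩ :
      (X ^ 8 + C a * X ^ 4 + C (s * s) : ℚ[X]).rootSet L) := by
  refine (Fintype.bijective_iff_surjective_and_card _).2 ⟨?_, ?_⟩
  · rintro ⟨y, hy⟩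
    obtain ⟨k, hk⟩ := D.exists_root_eq (ne_zero_of_irreducible hf) (mem_rootSet_iff.1 hy)
    exact ⟨k, Subtype.ext hk⟩
  · rw [card_rootSet_eq_natDegree hf.separable hsplit]
    have : (X ^ 8 + C a * X ^ 4 + C (s * s) : ℚ[X]).natDegree = 8 := by compute_degree!
    rw [this]
    rfl

/-- Transitivity: all roots share the minimal polynomial `f`, so they are conjugate in a normal
extension. -/
theorem exists_hasCode_of_label [Normal ℚ L] (D : OcticRoot a s L) (k : RootLabel) :
    ∃ σ x, D.HasCode σ x ∧ x.1 = k := by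
  have hmin : ∀ y : L, y ^ 8 + algebraMap ℚ L a * y ^ 4 + algebraMap ℚ L s ^ 2 = 0 →
      X ^ 8 + C a * X ^ 4 + C (s * s) = minpoly ℚ y := fun y hy =>
    minpoly.eq_of_irreducible_of_monic hf (by simpa [sq] using hy) (by monicity!)
  obtain ⟨σ, hσ⟩ := (Normal.minpoly_eq_iff_mem_orbit (F := ℚ) L (x := D.root k) (y := D.α)).1
    ((hmin _ (D.root_eq_zero k)).symm.trans (hmin _ D.eq_zero))
  obtain ⟨x, hx⟩ := D.exists_hasCode_of_map_eq σ hσ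
  exact ⟨σ, x, hx⟩

/-- Only the right-to-left direction needs transitivity: orthogonality to `W` passes to every
exponent vector giving a square, that is, to the whole annihilator of the realized signs, and
`AutCode.mem_of_signs` applies. -/
theorem mem_code_iff [FiniteDimensional ℚ L] [IsGalois ℚ L] (D : OcticRoot a s L)
    {W : List ExpVec} (hW : ∀ w ∈ W, IsSquare (∏ j, radicand a s j ^ (w j).val))
    (hW' : ∀ w, IsSquare (∏ j, radicand a s j ^ (w j).val) → ∃ l ∈ W.sublists, w = l.sum)
    (x : AutCode) : (∃ σ, D.HasCode σ x) ↔ ∀ w ∈ W, w ⬝ᵥ x.signs = 0 := by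
  have hs := ne_zero_of_irreducible hf
  have hiff := D.isSquare_prod_radicand_iff hs (radicand_ne_zero hf)
  constructor
  · rintro ⟨σ, hσ⟩ w hw
    exact (hiff w).1 (hW w hw) σ x hσ
  · intro hx
    refine AutCode.mem_of_signs (S := {x | ∃ σ, D.HasCode σ x}) ?_ (fun k => ?_) x fun w hw => ?_
    · rintro x ⟨σ, hσ⟩ y ⟨τ, hτ⟩
      exact ⟨σ * τ, hσ.mul hs hτ⟩
    · obtain ⟨σ, x, hx, hk⟩ := exists_hasCode_of_label hf D k
      exact ⟨x, ⟨σ, hx⟩, hk⟩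
    · obtain ⟨l, hl, rfl⟩ := hW' w ((hiff w).2 fun σ x hσ => hw x ⟨σ, hσ⟩)
      rw [List.mem_sublists] at hl
      have : ∀ l' : List ExpVec, (∀ w ∈ l', w ⬝ᵥ x.signs = 0) → l'.sum ⬝ᵥ x.signs = 0 := by
        intro l' h
        induction l' with
        | nil => simp
        | cons u l' ih =>
          rw [List.sum_cons, add_dotProduct, h u (by simp),
            ih fun w hw => h w (List.mem_cons_of_mem _ hw), add_zero]
      exact this l fun w hw => hx w (hl.subset hw)

/-- The Galois action on the roots in any splitting normal extension. -/
theorem exists_numbering [FiniteDimensional ℚ L] [IsGalois ℚ L]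
    [Fact (((X ^ 8 + C a * X ^ 4 + C (s * s) : ℚ[X]).map (algebraMap ℚ L)).Splits)]
    (hs : 0 < s) :
    ∃ e : (X ^ 8 + C a * X ^ 4 + C (s * s) : ℚ[X]).rootSet L ≃ Fin 8,
      (Gal.galActionHom (X ^ 8 + C a * X ^ 4 + C (s * s) : ℚ[X]) L).range.map
        e.permCongrHom.toMonoidHom = (deocticAlgorithm a (s * s)).group := by
  set f : ℚ[X] := X ^ 8 + C a * X ^ 4 + C (s * s) with hfdef
  obtain ⟨D⟩ := nonempty_of_splits (a := a) (s := s) (L := L) Fact.out hs.ne'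
  obtain ⟨c, hc, hlabel, hW, hW'⟩ := exists_mem_table hf hs D
  obtain ⟨hinj, hgen, hword⟩ := table_represents c hc
  have hmem := mem_code_iff hf D hW hW'
  rw [hlabel] at hgen hword
  let r := Equiv.ofBijective _ (root_bijective hf Fact.out D)
  let π := Equiv.ofBijective (numbering c.2.1)
    ((Fintype.bijective_iff_injective_and_card _).2 ⟨hinj, rfl⟩)
  let e : f.rootSet L ≃ Fin 8 := r.symm.trans π
  have hact : ∀ σ x, D.HasCode σ x → ∀ k,
      e.permCongrHom (Gal.galActionHom f L (Gal.restrict f L σ)) (π k) = π (x.act k) := by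
    intro σ x hx k
    have hk : Gal.galActionHom f L (Gal.restrict f L σ) (r k) = r (x.act k) :=
      Subtype.ext ((Gal.galActionHom_restrict f L σ (r k)).trans (hx.map_root hs.ne' k))
    change π (r.symm (Gal.galActionHom f L (Gal.restrict f L σ) (r (π.symm (π k))))) = _
    rw [Equiv.symm_apply_apply, hk, Equiv.symm_apply_apply]
  refine ⟨e, le_antisymm ?_ ?_⟩
  · rintro _ ⟨_, ⟨ψ, rfl⟩, rfl⟩
    obtain ⟨σ, rfl⟩ := Gal.restrict_surjective f L ψ
    obtain ⟨x, hx⟩ := D.exists_hasCode hs.ne' σ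
    obtain ⟨l, hl, hlx⟩ := hword x ((hmem x).1 ⟨σ, hx⟩)
    have heq : e.permCongrHom (Gal.galActionHom f L (Gal.restrict f L σ)) = l.prod := by
      ext1 j
      obtain ⟨k, rfl⟩ := π.surjective j
      exact (hact σ x hx k).trans (hlx k).symm
    change e.permCongrHom (Gal.galActionHom f L (Gal.restrict f L σ)) ∈ _
    rw [heq, group_eq_closure]
    exact Subgroup.list_prod_mem _ fun g hg =>
      Subgroup.subset_closure ((List.mem_sublists.1 hl).subset hg)
  · rw [group_eq_closure, Subgroup.closure_le]
    intro g hg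
    obtain ⟨x, hx, hgx⟩ := hgen g hg
    obtain ⟨σ, hσ⟩ := (hmem x).2 hx
    refine ⟨_, ⟨Gal.restrict f L σ, rfl⟩, ?_⟩
    change e.permCongrHom (Gal.galActionHom f L (Gal.restrict f L σ)) = g
    ext1 j
    obtain ⟨k, rfl⟩ := π.surjective j
    exact (hact σ x hσ k).trans (hgx k).symm

end OcticRoot

theorem theorem3p5 (a b : ℚ) (hb : IsSquare b)
    (hf : Irreducible (X ^ 8 + C a * X ^ 4 + C b : ℚ[X])) :
    HasGaloisLabel (X ^ 8 + C a * X ^ 4 + C b) (deocticAlgorithm a b) := by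
  obtain ⟨t, rfl⟩ := hb
  -- The nonnegative root is the one returned by `Rat.sqrt`; irreducibility later makes it positive.
  obtain ⟨s, hs, hst⟩ : ∃ s : ℚ, 0 ≤ s ∧ s * s = t * t := ⟨|t|, abs_nonneg t, abs_mul_abs_self t⟩
  rw [← hst] at hf ⊢
  have : Fact (((X ^ 8 + C a * X ^ 4 + C (s * s) : ℚ[X]).map (algebraMap ℚ
    (X ^ 8 + C a * X ^ 4 + C (s * s) : ℚ[X]).SplittingField)).Splits) :=
    ⟨SplittingField.splits _⟩
  have : IsSplittingField ℚ (X ^ 8 + C a * X ^ 4 + C (s * s) : ℚ[X]).SplittingField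
      (X ^ 8 + C a * X ^ 4 + C (s * s)) := IsSplittingField.splittingField _
  have : IsGalois ℚ (X ^ 8 + C a * X ^ 4 + C (s * s) : ℚ[X]).SplittingField :=
    IsGalois.of_separable_splitting_field hf.separable
  exact OcticRoot.exists_numbering hf (hs.lt_of_ne (ne_zero_of_irreducible hf).symm)
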